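/- Let $\rho\in\mathbb R$ and let $\mathbb M^3(\rho)$ be the three-dimensional space form of constant sectional curvature $\rho$: Euclidean space if $\rho=0$, the round sphere in $\mathbb R^4$ if $\rho>0$, and the hyperboloid model of hyperbolic space in Lorentz space $\mathbb R^{4}_1$ if $\rho<0$. Let $S$ be an oriented immersed smooth surface in $\mathbb M^3(\rho)$ with unit normal $\eta$, which is rotational, that is, invariant under a nontrivial one-parameter group of rotations of $\mathbb M^3(\rho)$. (Such a group leaves a geodesic, the rotation axis, pointwise fixed; in hyperbolic space, besides these spherical rotations, the hyperbolic and parabolic ones are allowed too, which leave a spacelike, respectively degenerate, two-dimensional linear subspace of $\mathbb R^4_1$ pointwise fixed.) Suppose that $S$ has constant astigmatism: its principal curvatures (the eigenvalues of $v\mapsto-\nabla_v\eta$) can be labelled $\kappa_1,\kappa_2$ at each point so that they are non-zero and $$\frac1{\kappa_1}-\frac1{\kappa_2}=c$$ on $S$ with a constant $c\neq0$. Let $\gamma=\gamma(s)$ be a profile curve of $S$: a smooth curve on $S$, defined on an open interval and parametrized by arc length, that lies in a totally geodesic surface of $\mathbb M^3(\rho)$ containing the rotation axis (for the hyperbolic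 and parabolic rotations: a totally geodesic surface cut out by a three-dimensional linear subspace that contains the fixed one). Then either $\kappa_2$ is the principal curvature of $S$ in the direction of $\gamma'$ along all of $\gamma$, and we put $N=-\eta$, or $\kappa_1$ is, and we put $N=\eta$. In both cases $N$ is a unit normal of $\gamma$ with $\nabla_{\gamma'}\gamma'=\kappa N$ for a smooth function $\kappa$, the signed curvature of $\gamma$ (so $\kappa_2=-\kappa$ in the first case and $\kappa_1=\kappa$ in the second); $\kappa$ has no zeros; and $\gamma$ satisfies, with $\mu=1/c$, the Euler–Lagrange equation $$\frac{d^2}{ds^2}\left(\left(1-\frac{\mu}{\kappa}\right)e^{\mu/\kappa}\right)+\left(\rho\left(1-\frac{\mu}{\kappa}\right)-\mu\kappa\right)e^{\mu/\kappa}=0$$ of the curvature energy $\mathbf\Theta_\mu(\gamma)=\int_\gamma\kappa\,e^{\mu/\kappa}\,ds$. (Profile curves of constant curvature are included.) -/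

import Mathlib

open scoped ContDiff Manifold

noncomputable section

namespace SpaceForms

/-- Ambient vector space of the quadric models of the three-dimensional space forms. -/
abbrev Amb : Type := Fin 4 → ℝ

/-- The ambient bilinear form `u₀ v₀ / ρ + u₁ v₁ + u₂ v₂ + u₃ v₃`. It is positive definite for
`ρ > 0` and Lorentzian for `ρ < 0`. For `ρ = 0` the first summand is `0`, and the form restricts to
the Euclidean inner product on the tangent spaces `{v | v₀ = 0}` of the affine space `{x | x₀ = 1}`. -/
def form (ρ : ℝ) (u v : Amb) : ℝ :=
  u 0 * v 0 / ρ + u 1 * v 1 + u 2 * v 2 + u 3 * v 3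

/-- The space form `M³(ρ)`, with the Riemannian metric induced by `form ρ`. After rescaling `x₀` by
`1 / √|ρ|` this is the round sphere of radius `1 / √ρ` in `ℝ⁴` if `ρ > 0`, and the upper sheet
of the hyperboloid `⟨x, x⟩ = 1 / ρ` in Lorentz space if `ρ < 0`; for `ρ = 0` it is
`{x | x₀ = 1}`, Euclidean three-space. -/
def spaceForm (ρ : ℝ) : Set Amb :=
  {x | x 0 ^ 2 + ρ * (x 1 ^ 2 + x 2 ^ 2 + x 3 ^ 2) = 1 ∧ (ρ ≤ 0 → 0 < x 0)}

/-- `v` is tangent to `M³(ρ)` at the point `x`. -/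
def IsTangent (ρ : ℝ) (x v : Amb) : Prop :=
  x 0 * v 0 + ρ * (x 1 * v 1 + x 2 * v 2 + x 3 * v 3) = 0

/-- Covariant acceleration `∇_{α'} α'` in `M³(ρ)` of a curve `α` in `M³(ρ)`: the tangential part
of the ambient second derivative (the second fundamental form of the quadric at `x` is
`(u, v) ↦ -ρ ⟨u, v⟩ x`). -/
def covAccel (ρ : ℝ) (α : ℝ → Amb) (s : ℝ) : Amb :=
  deriv (deriv α) s + (ρ * form ρ (deriv α s) (deriv α s)) • α s

/-- The (restriction of the) linear map `L` is an isometric map of `M³(ρ)` into itself. -/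
def IsIsometry (ρ : ℝ) (L : Amb →L[ℝ] Amb) : Prop :=
  (∀ x ∈ spaceForm ρ, L x ∈ spaceForm ρ) ∧
  ∀ x ∈ spaceForm ρ, ∀ u v : Amb, IsTangent ρ x u → IsTangent ρ x v →
    form ρ (L u) (L v) = form ρ u v

/-- `φ` is a (nontrivial, smooth) one-parameter group of rotations of `M³(ρ)`, leaving the
two-dimensional linear subspace `P` pointwise fixed. When `P` meets `M³(ρ)`, the intersection is a
geodesic, the rotation axis. This is always so for `ρ > 0`, and it is required for `ρ = 0`. For
`ρ < 0` the three types of rotations are allowed: spherical if `P` meets `M³(ρ)`, that is, if `P` is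
Lorentzian, hyperbolic if `P` is spacelike, and parabolic if `P` is degenerate. -/
structure IsRotationGroup (ρ : ℝ) (P : Submodule ℝ Amb) (φ : ℝ → Amb →L[ℝ] Amb) : Prop where
  smooth : ContDiff ℝ ∞ φ
  map_zero : φ 0 = ContinuousLinearMap.id ℝ Amb
  map_add : ∀ s t : ℝ, φ (s + t) = (φ s).comp (φ t)
  isometry : ∀ t : ℝ, IsIsometry ρ (φ t)
  nontrivial : ∃ t : ℝ, φ t ≠ ContinuousLinearMap.id ℝ Amb
  finrank_fixed : Module.finrank ℝ P = 2
  fixed : ∀ t : ℝ, ∀ x ∈ P, φ t x = x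
  axis : 0 ≤ ρ → ∃ x ∈ P, x ∈ spaceForm ρ

section Surfaces

variable {S : Type*} [TopologicalSpace S] [ChartedSpace (EuclideanSpace ℝ (Fin 2)) S]

/-- Differential at `p` of a map from the surface `S` to the ambient vector space. -/
def diffl (g : S → Amb) (p : S) : TangentSpace (𝓡 2) p →L[ℝ] Amb :=
  mfderiv (𝓡 2) 𝓘(ℝ, Amb) g p

variable (S) in
/-- An oriented (immersed) surface `pos : S → M³(ρ)` with its unit normal field `nor`. -/
structure OrientedSurface (ρ : ℝ) where
  pos : S → Amb
  nor : S → Amb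
  pos_smooth : ContMDiff (𝓡 2) 𝓘(ℝ, Amb) ∞ pos
  nor_smooth : ContMDiff (𝓡 2) 𝓘(ℝ, Amb) ∞ nor
  pos_mem : ∀ p, pos p ∈ spaceForm ρ
  immersion : ∀ p, Function.Injective (diffl pos p)
  nor_tangent : ∀ p, IsTangent ρ (pos p) (nor p)
  nor_unit : ∀ p, form ρ (nor p) (nor p) = 1
  nor_orth : ∀ p, ∀ v : TangentSpace (𝓡 2) p, form ρ (nor p) (diffl pos p v) = 0

/-- `k₁`, `k₂` are the principal curvatures at `p`, that is, the eigenvalues (with multiplicity) of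
the shape operator `v ↦ -∇_v η` of the surface with unit normal `η`, for an orthonormal basis of
principal directions. Since `⟨v, η⟩ = 0`, the covariant derivative `∇_v η` in `M³(ρ)` is the
ambient derivative of `η` in the direction `v`. -/
def OrientedSurface.HasPrincipalCurvatures {ρ : ℝ} (X : OrientedSurface S ρ) (p : S)
    (k₁ k₂ : ℝ) : Prop :=
  ∃ e₁ e₂ : TangentSpace (𝓡 2) p,
    form ρ (diffl X.pos p e₁) (diffl X.pos p e₁) = 1 ∧
    form ρ (diffl X.pos p e₂) (diffl X.pos p e₂) = 1 ∧
    form ρ (diffl X.pos p e₁) (diffl X.pos p e₂) = 0 ∧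
    diffl X.nor p e₁ = -(k₁ • diffl X.pos p e₁) ∧
    diffl X.nor p e₂ = -(k₂ • diffl X.pos p e₂)

/-- The surface has non-zero principal curvatures `κ₁`, `κ₂` with `1 / κ₁ - 1 / κ₂ = c`. -/
def OrientedSurface.ConstantAstigmatism {ρ : ℝ} (X : OrientedSurface S ρ) (κ₁ κ₂ : S → ℝ)
    (c : ℝ) : Prop :=
  ∀ p, X.HasPrincipalCurvatures p (κ₁ p) (κ₂ p) ∧ κ₁ p ≠ 0 ∧ κ₂ p ≠ 0 ∧
    1 / κ₁ p - 1 / κ₂ p = c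

/-- The surface is invariant under the one-parameter group `φ`: through each of its points it
contains the whole orbit of that point. As the surface is only immersed, the orbit is required
to lift to a smooth curve in `S`. -/
def OrientedSurface.IsInvariant {ρ : ℝ} (X : OrientedSurface S ρ)
    (φ : ℝ → Amb →L[ℝ] Amb) : Prop :=
  ∀ p : S, ∃ o : ℝ → S, ContMDiff 𝓘(ℝ, ℝ) (𝓡 2) ∞ o ∧ o 0 = p ∧
    ∀ t : ℝ, X.pos (o t) = φ t (X.pos p)

/-- `γ : I → S` is a profile curve, parametrized by arc length, of a surface invariant under
rotations that fix `P`: it lies in a totally geodesic surface `W ∩ M³(ρ)`, a two-dimensional space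
form of curvature `ρ`, where `W` is a three-dimensional linear subspace containing `P` (so this
totally geodesic surface contains the rotation axis). -/
structure OrientedSurface.IsProfileCurve {ρ : ℝ} (X : OrientedSurface S ρ)
    (P : Submodule ℝ Amb) (I : Set ℝ) (γ : ℝ → S) : Prop where
  smooth : ContMDiffOn 𝓘(ℝ, ℝ) (𝓡 2) ∞ γ I
  planar : ∃ W : Submodule ℝ Amb, Module.finrank ℝ W = 3 ∧ P ≤ W ∧ ∀ s ∈ I, X.pos (γ s) ∈ W
  unit_speed : ∀ s ∈ I,
    form ρ (deriv (fun u => X.pos (γ u)) s) (deriv (fun u => X.pos (γ u)) s) = 1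

end Surfaces

/-- The Euler-Lagrange equation, at the parameter `s`, of the energy `∫ κ exp(μ / κ) ds` on curves
in the two-dimensional space form of curvature `ρ`; `κ` is the curvature as a function of arc
length. -/
def EulerLagrange (ρ μ : ℝ) (κ : ℝ → ℝ) (s : ℝ) : Prop :=
  deriv (deriv (fun u => (1 - μ / κ u) * Real.exp (μ / κ u))) s
    + (ρ * (1 - μ / κ s) - μ * κ s) * Real.exp (μ / κ s) = 0

end SpaceForms

end

/-!
The proof works with the generator `A` of the group of rotations and with one linear functional.

*The rotations.* `A` is skew for a nondegenerate symmetric bilinear form `F` on the ambient space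
which agrees with the metric on tangent vectors (`IsRotationGroup.exists_invariant_form`). Its kernel
is the fixed plane `P`, and it maps a hyperplane `W` containing `P` and a point of `M³(ρ)` outside
`P` into the line orthogonal to `W`, spanned by a vector `b`
(`IsRotationGroup.generator_meridian_plane`): along a profile curve the orbits point in the constant
direction `b`, and `β A y = ℓ(y) b` for `y` in `W`, where `ℓ(y) = F(A y, b)` and `β = F(b, b)`. This treats the three signs of `ρ` and the three kinds of rotations at once.

*The profile curve.* The Killing field `ξ = A x` is tangent to the surface, so `⟨ξ, η⟩ = 0`. The
second derivative of this identity shows that the surface would be umbilic at a point of the axis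
(`IsInvariant.pos_notMem_fixed`), which constant astigmatism with `c ≠ 0` excludes. So `ℓ(x) ≠ 0`
along the profile curve `x`, and the normal `η` and its derivative lie in `W`. Hence `x'` is a
principal direction, with principal curvature `k` say, and the orbit has the other one, `l`; moreover
`x'' + ρ x = k η`, `η' = -k x'` and `l ℓ(x) = -ℓ(η)` (`IsProfileCurve.exists_structure`).

*The Euler-Lagrange equation.* Put `r = ℓ(x)` and `q = ℓ(η)`. Then `r'' = k q - ρ r`, `q' = -k r'`,
and `1 / k - 1 / l = 1 / k + r / q` is `c` or `-c`; by continuity the sign is the same along the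
curve, and changing the sign of `η` makes it `c`. In that case `exp (μ / κ)` has the same logarithmic
derivative as `q`, so that `(1 - μ / κ) exp (μ / κ) = μ (r / q) exp (μ / κ)` is a constant
multiple of `r`, and the linear equation for `r''` becomes the Euler-Lagrange equation
(`eulerLagrange_of_frame`).
-/

namespace SpaceForms

/-! ### The metric and tangent vectors of a space form -/

section Form

variable (ρ : ℝ)

lemma form_add_left (u v w : Amb) : form ρ (u + v) w = form ρ u w + form ρ v w := by
  simp only [form, Pi.add_apply]; ring

lemma form_smul_left (a : ℝ) (u w : Amb) : form ρ (a • u) w = a * form ρ u w := by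
  simp only [form, Pi.smul_apply, smul_eq_mul]; ring

lemma form_comm (u v : Amb) : form ρ u v = form ρ v u := by
  simp only [form]; ring

lemma form_add_right (u v w : Amb) : form ρ u (v + w) = form ρ u v + form ρ u w := by
  simp only [form, Pi.add_apply]; ring

lemma form_smul_right (a : ℝ) (u w : Amb) : form ρ u (a • w) = a * form ρ u w := by
  simp only [form, Pi.smul_apply, smul_eq_mul]; ring

lemma form_neg_left (u w : Amb) : form ρ (-u) w = -form ρ u w := by
  simp only [form, Pi.neg_apply]; ring

lemma form_neg_right (u w : Amb) : form ρ u (-w) = -form ρ u w := by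
  simp only [form, Pi.neg_apply]; ring

/-- The scaled bilinear form `x₀ v₀ + ρ (x₁ v₁ + x₂ v₂ + x₃ v₃)`, whose kernel at `x` is the
tangent space of `M³(ρ)` at `x`. Unlike `form ρ`, it depends polynomially on `ρ`. -/
def tangForm (x v : Amb) : ℝ :=
  x 0 * v 0 + ρ * (x 1 * v 1 + x 2 * v 2 + x 3 * v 3)

variable {ρ}

lemma hasDerivAt_form {u v : ℝ → Amb} {u' v' : Amb} {s : ℝ} (hu : HasDerivAt u u' s)
    (hv : HasDerivAt v v' s) :
    HasDerivAt (fun t => form ρ (u t) (v t)) (form ρ u' (v s) + form ρ (u s) v') s := by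
  have h1 := hasDerivAt_pi.1 hu
  have h2 := hasDerivAt_pi.1 hv
  have := (((((h1 0).mul (h2 0)).div_const ρ).add ((h1 1).mul (h2 1))).add
    ((h1 2).mul (h2 2))).add ((h1 3).mul (h2 3))
  refine HasDerivAt.congr_deriv (f := fun t => form ρ (u t) (v t)) this ?_
  simp only [form]; ring

lemma hasDerivAt_tangForm {u v : ℝ → Amb} {u' v' : Amb} {s : ℝ} (hu : HasDerivAt u u' s)
    (hv : HasDerivAt v v' s) :
    HasDerivAt (fun t => tangForm ρ (u t) (v t))
      (tangForm ρ u' (v s) + tangForm ρ (u s) v') s := by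
  have h1 := hasDerivAt_pi.1 hu
  have h2 := hasDerivAt_pi.1 hv
  have := ((h1 0).mul (h2 0)).add (((((h1 1).mul (h2 1))).add
    ((h1 2).mul (h2 2))).add ((h1 3).mul (h2 3)) |>.const_mul ρ)
  refine HasDerivAt.congr_deriv (f := fun t => tangForm ρ (u t) (v t)) this ?_
  simp only [tangForm]; ring

lemma isTangent_iff {x v : Amb} : IsTangent ρ x v ↔ tangForm ρ x v = 0 := Iff.rfl

lemma tangForm_self {x : Amb} (hx : x ∈ spaceForm ρ) : tangForm ρ x x = 1 := by
  rw [← hx.1, tangForm]; ring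

lemma tangForm_comm (x y : Amb) : tangForm ρ x y = tangForm ρ y x := by
  simp only [tangForm]; ring

/-- Tangent vectors of Euclidean space `{x | x₀ = 1}` have vanishing zeroth coordinate. -/
lemma IsTangent.zero_of_flat {x v : Amb} (hx : x ∈ spaceForm ρ) (hv : IsTangent ρ x v)
    (h : ρ = 0) : v 0 = 0 := by
  subst h
  have h0 := hx.2 le_rfl
  simpa [IsTangent, h0.ne'] using hv

lemma tangForm_eq_mul_form {u v : Amb} (hu : ρ = 0 → u 0 = 0) :
    tangForm ρ u v = ρ * form ρ u v := by
  by_cases h : ρ = 0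
  · simp [tangForm, h, hu h]
  · simp only [tangForm, form]; field_simp; ring

lemma IsTangent.add {x u v : Amb} (hu : IsTangent ρ x u) (hv : IsTangent ρ x v) :
    IsTangent ρ x (u + v) := by
  simp only [IsTangent, Pi.add_apply] at *; linarith

lemma IsTangent.smul {x u : Amb} (a : ℝ) (hu : IsTangent ρ x u) : IsTangent ρ x (a • u) := by
  simp only [IsTangent, Pi.smul_apply, smul_eq_mul] at *
  linear_combination a * hu

/-- Three orthogonal non-null tangent vectors at `x` form, together with `x`, a basis of the
ambient space. -/
lemma exists_eq_add_of_orthogonal {x t₁ t₂ t₃ : Amb} (hx : x ∈ spaceForm ρ)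
    (h₁ : IsTangent ρ x t₁) (h₂ : IsTangent ρ x t₂) (h₃ : IsTangent ρ x t₃)
    (n₁ : form ρ t₁ t₁ ≠ 0) (n₂ : form ρ t₂ t₂ ≠ 0) (n₃ : form ρ t₃ t₃ ≠ 0)
    (h₁₂ : form ρ t₁ t₂ = 0) (h₁₃ : form ρ t₁ t₃ = 0) (h₂₃ : form ρ t₂ t₃ = 0) (y : Amb) :
    ∃ a b₁ b₂ b₃ : ℝ, y = a • x + b₁ • t₁ + b₂ • t₂ + b₃ • t₃ := by
  have hli : LinearIndependent ℝ ![x, t₁, t₂, t₃] := by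
    rw [Fintype.linearIndependent_iff]
    intro g hg
    simp only [Fin.sum_univ_four, Matrix.cons_val] at hg
    have h0 : g 0 = 0 := by
      have : tangForm ρ x (g 0 • x + g 1 • t₁ + g 2 • t₂ + g 3 • t₃) = g 0 := by
        have e : tangForm ρ x (g 0 • x + g 1 • t₁ + g 2 • t₂ + g 3 • t₃)
          = g 0 * tangForm ρ x x + g 1 * tangForm ρ x t₁ + g 2 * tangForm ρ x t₂
            + g 3 * tangForm ρ x t₃ := by
          simp only [tangForm, Pi.add_apply, Pi.smul_apply, smul_eq_mul]; ring
        rw [e, tangForm_self hx, isTangent_iff.1 h₁, isTangent_iff.1 h₂, isTangent_iff.1 h₃]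
        ring
      rw [hg] at this
      simpa [tangForm] using this.symm
    rw [h0, zero_smul, zero_add] at hg
    have key : ∀ t, g 1 * form ρ t₁ t + g 2 * form ρ t₂ t + g 3 * form ρ t₃ t = 0 := by
      intro t
      rw [← form_smul_left, ← form_smul_left, ← form_smul_left, ← form_add_left, ← form_add_left,
        hg]
      simp [form]
    have k1 := key t₁
    have k2 := key t₂
    have k3 := key t₃
    rw [form_comm ρ t₂ t₁, form_comm ρ t₃ t₁, h₁₂, h₁₃] at k1
    rw [form_comm ρ t₃ t₂, h₁₂, h₂₃] at k2
    rw [h₁₃, h₂₃] at k3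
    simp only [mul_zero, add_zero, zero_add, mul_eq_zero, n₁, n₂, n₃, or_false] at k1 k2 k3
    intro i
    fin_cases i <;> assumption
  have hspan := hli.span_eq_top_of_card_eq_finrank' (by simp)
  have hy : y ∈ Submodule.span ℝ (Set.range ![x, t₁, t₂, t₃]) := hspan ▸ Submodule.mem_top
  obtain ⟨g, hg⟩ := (Submodule.mem_span_range_iff_exists_fun ℝ).1 hy
  refine ⟨g 0, g 1, g 2, g 3, ?_⟩
  rw [← hg]
  simp [Fin.sum_univ_four]

end Form

/-- A vector of `V` outside a hyperplane `U` of `V` spans `V` together with `U`. -/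
lemma exists_sub_smul_mem {E : Type*} [AddCommGroup E] [Module ℝ E] [FiniteDimensional ℝ E]
    {U V : Submodule ℝ E} (hUV : U ≤ V) (hd : Module.finrank ℝ V = Module.finrank ℝ U + 1)
    {z : E} (hz : z ∈ V) (hzU : z ∉ U) {y : E} (hy : y ∈ V) : ∃ t : ℝ, y - t • z ∈ U := by
  have hle : U ⊔ Submodule.span ℝ {z} ≤ V := sup_le hUV (by simpa using hz)
  have hlt : U < U ⊔ Submodule.span ℝ {z} := by
    refine lt_of_le_of_ne le_sup_left fun h => hzU ?_
    rw [h]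
    exact Submodule.mem_sup_right (Submodule.mem_span_singleton_self z)
  have := Submodule.finrank_lt_finrank_of_lt hlt
  have heq := Submodule.eq_of_le_of_finrank_le hle (by omega)
  rw [← heq] at hy
  obtain ⟨u, hu, w, hw, rfl⟩ := Submodule.mem_sup.1 hy
  obtain ⟨t, rfl⟩ := Submodule.mem_span_singleton.1 hw
  exact ⟨t, by simpa using hu⟩

/-! ### The generator of a group of rotations -/

namespace IsRotationGroup

variable {ρ : ℝ} {P : Submodule ℝ Amb} {φ : ℝ → Amb →L[ℝ] Amb}

lemma hasDerivAt_zero (h : IsRotationGroup ρ P φ) : HasDerivAt φ (deriv φ 0) 0 :=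
  (h.smooth.differentiable (by simp) 0).hasDerivAt

lemma hasDerivAt_apply (h : IsRotationGroup ρ P φ) (x : Amb) :
    HasDerivAt (fun t => φ t x) (deriv φ 0 x) 0 := by
  simpa using h.hasDerivAt_zero.clm_apply (hasDerivAt_const 0 x)

/-- The infinitesimal generator of a nontrivial one-parameter group does not vanish. -/
lemma generator_ne_zero (h : IsRotationGroup ρ P φ) : deriv φ 0 ≠ 0 := by
  intro h0
  obtain ⟨t, ht⟩ := h.nontrivial
  have hd : ∀ s, deriv φ s = 0 := by
    intro s
    have h1 : HasDerivAt (fun t => φ (t - s)) (deriv φ 0) s := by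
      have := h.hasDerivAt_zero
      rw [← sub_self s] at this
      simpa using HasDerivAt.comp_sub_const s s (by simpa using this)
    have h2 : HasDerivAt (fun t => (φ s).comp (φ (t - s))) ((φ s).comp (deriv φ 0)) s := by
      simpa using (hasDerivAt_const s (φ s)).clm_comp h1
    have h3 : (fun t => (φ s).comp (φ (t - s))) = φ := by
      funext t
      rw [← h.map_add]; congr 1; ring
    rw [h3, h0] at h2
    simpa using h2.deriv
  apply ht
  rw [← h.map_zero]
  exact is_const_of_deriv_eq_zero (h.smooth.differentiable (by simp)) hd t 0

lemma generator_apply_fixed (h : IsRotationGroup ρ P φ) {x : Amb} (hx : x ∈ P) :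
    deriv φ 0 x = 0 := by
  have h1 := h.hasDerivAt_apply x
  simp only [h.fixed _ x hx] at h1
  exact h1.unique (hasDerivAt_const 0 x)

lemma isTangent_generator (h : IsRotationGroup ρ P φ) {x : Amb} (hx : x ∈ spaceForm ρ) :
    IsTangent ρ x (deriv φ 0 x) := by
  have h1 := hasDerivAt_tangForm (ρ := ρ) (h.hasDerivAt_apply x) (h.hasDerivAt_apply x)
  simp only [tangForm_self ((h.isometry _).1 x hx)] at h1
  have := h1.unique (hasDerivAt_const 0 1)
  rw [h.map_zero, ContinuousLinearMap.id_apply, tangForm_comm] at this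
  rw [isTangent_iff]; linarith

lemma form_generator_add (h : IsRotationGroup ρ P φ) {x u v : Amb} (hx : x ∈ spaceForm ρ)
    (hu : IsTangent ρ x u) (hv : IsTangent ρ x v) :
    form ρ (deriv φ 0 u) v + form ρ u (deriv φ 0 v) = 0 := by
  have h1 := hasDerivAt_form (ρ := ρ) (h.hasDerivAt_apply u) (h.hasDerivAt_apply v)
  simp only [(h.isometry _).2 x hx u v hu hv] at h1
  simpa [h.map_zero] using h1.unique (hasDerivAt_const 0 _)

/-- In the curved case the generator is skew on the whole ambient space. The
quadratic form `u ↦ ⟨A u, u⟩` vanishes on `M³(ρ)`, hence on the open cone of its positive multiples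
around `(1, 0, 0, 0)`, and a quadratic form vanishing on an open set is zero. -/
lemma form_generator_self (h : IsRotationGroup ρ P φ) (hρ : ρ ≠ 0) (u : Amb) :
    form ρ (deriv φ 0 u) u = 0 := by
  set A := deriv φ 0
  have hcone : ∀ y : Amb, 0 < tangForm ρ y y → 0 < y 0 → form ρ (A y) y = 0 := by
    intro y hQ h0
    set q := √(tangForm ρ y y) with hq
    have hq0 : 0 < q := Real.sqrt_pos.2 hQ
    have hqq : q ^ 2 = tangForm ρ y y := Real.sq_sqrt hQ.le
    have hm : q⁻¹ • y ∈ spaceForm ρ := by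
      refine ⟨?_, fun _ => by simp only [Pi.smul_apply, smul_eq_mul]; positivity⟩
      simp only [Pi.smul_apply, smul_eq_mul]
      have : (q⁻¹ * y 0) ^ 2 + ρ * ((q⁻¹ * y 1) ^ 2 + (q⁻¹ * y 2) ^ 2 + (q⁻¹ * y 3) ^ 2)
        = (q ^ 2)⁻¹ * tangForm ρ y y := by simp only [tangForm]; ring
      rw [this, hqq, inv_mul_cancel₀ hQ.ne']
    have ht := isTangent_iff.1 (h.isTangent_generator hm)
    rw [tangForm_eq_mul_form (fun h => absurd h hρ)] at ht
    have h1 := (mul_eq_zero.1 ht).resolve_left hρ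
    rw [map_smul, form_smul_left, form_smul_right, form_comm] at h1
    simpa [hq0.ne'] using h1
  let e : Amb := Pi.single 0 1
  have hc : Filter.Tendsto (fun ε : ℝ => e + ε • u) (nhds 0) (nhds e) := by
    have : Continuous (fun ε : ℝ => e + ε • u) := by fun_prop
    simpa using this.tendsto 0
  have ho : ∀ᶠ y in nhds e, 0 < tangForm ρ y y ∧ 0 < y 0 := by
    refine ((Continuous.tendsto ?_ e).eventually_const_lt ?_).and
      ((Continuous.tendsto ?_ e).eventually_const_lt ?_)
    · unfold tangForm; fun_prop
    · simp [tangForm, e]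
    · fun_prop
    · simp [e]
  have h1 := hc.eventually ho
  have h2 : ∀ᶠ ε : ℝ in nhds 0, 0 < tangForm ρ (e + (-ε) • u) (e + (-ε) • u) ∧
      0 < (e + (-ε) • u) 0 := by
    have : Filter.Tendsto (fun ε : ℝ => -ε) (nhds 0) (nhds 0) := by
      simpa using (continuous_neg (G := ℝ)).tendsto 0
    exact this.eventually h1
  have h3 : ∀ᶠ ε : ℝ in nhdsWithin 0 {0}ᶜ, ε ≠ 0 := eventually_mem_nhdsWithin
  obtain ⟨ε, hε, h1, h2⟩ :=
    (h3.and (((h1.and h2)).filter_mono nhdsWithin_le_nhds)).exists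
  have k0 := hcone e ho.self_of_nhds.1 ho.self_of_nhds.2
  have k1 := hcone _ h1.1 h1.2
  have k2 := hcone _ h2.1 h2.2
  simp only [_root_.map_add, map_smul, form_add_left, form_add_right, form_smul_left,
    form_smul_right] at k1 k2
  have : ε ^ 2 * form ρ (A u) u = 0 := by linear_combination (k1 + k2) / 2 - k0
  simpa [hε] using this

/-- There is a nondegenerate symmetric bilinear form `F` on the ambient space for which the
generator of the rotations is skew, and which agrees with the metric on tangent vectors. For
`ρ ≠ 0` it is `form ρ`; for `ρ = 0`, where `form ρ` is degenerate, the origin is moved to a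
point of the axis. -/
lemma exists_invariant_form (h : IsRotationGroup ρ P φ) :
    ∃ F : LinearMap.BilinForm ℝ Amb, (∀ u v, F u v = F v u) ∧
      (∀ u, (∀ v, F u v = 0) → u = 0) ∧
      (∀ u v, F (deriv φ 0 u) v = -F u (deriv φ 0 v)) ∧
      (∀ u v, (ρ = 0 → u 0 = 0) → (ρ = 0 → v 0 = 0) → F u v = form ρ u v) ∧
      ∀ u, ρ = 0 → deriv φ 0 u 0 = 0 := by
  set A := deriv φ 0 with hA
  by_cases hρ : ρ = 0
  · subst hρ
    obtain ⟨p, hpP, hp⟩ := h.axis le_rfl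
    have hmem : ∀ x : Amb, x 0 = 1 → x ∈ spaceForm 0 := fun x hx => by simp [spaceForm, hx]
    have hp0 : p 0 = 1 := by
      have := hp.1
      have := hp.2 le_rfl
      nlinarith
    have hA0 : ∀ u, A u 0 = 0 := by
      have h1 : ∀ x : Amb, x 0 = 1 → A x 0 = 0 := fun x hx =>
        (h.isTangent_generator (hmem x hx)).zero_of_flat (hmem x hx) rfl
      intro u
      have e : A u = A (u + (1 - u 0) • p) - (1 - u 0) • A p := by simp
      rw [e, Pi.sub_apply, Pi.smul_apply, h1 _ (by simp [hp0]), h1 p hp0]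
      simp
    have hAp : A p = 0 := h.generator_apply_fixed hpP
    refine ⟨LinearMap.mk₂ ℝ (fun u v => form 0 (u - u 0 • p) (v - v 0 • p) + u 0 * v 0)
      ?_ ?_ ?_ ?_, ?_, ?_, ?_, ?_, fun u _ => hA0 u⟩
    · intro u v w
      simp only [form, Pi.sub_apply, Pi.add_apply, Pi.smul_apply, smul_eq_mul]; ring
    · intro a u v
      simp only [form, Pi.sub_apply, Pi.smul_apply, smul_eq_mul]; ring
    · intro u v w
      simp only [form, Pi.sub_apply, Pi.add_apply, Pi.smul_apply, smul_eq_mul]; ring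
    · intro a u v
      simp only [form, Pi.sub_apply, Pi.smul_apply, smul_eq_mul]; ring
    · intro u v
      simp only [LinearMap.mk₂_apply, form, Pi.sub_apply, Pi.smul_apply, smul_eq_mul]; ring
    · intro u hu
      simp only [LinearMap.mk₂_apply] at hu
      have e0 : u 0 = 0 := by simpa [form, hp0] using hu p
      have e1 : u 1 = 0 := by simpa [form, hp0, e0] using hu (Pi.single 1 1)
      have e2 : u 2 = 0 := by simpa [form, hp0, e0] using hu (Pi.single 2 1)
      have e3 : u 3 = 0 := by simpa [form, hp0, e0] using hu (Pi.single 3 1)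
      funext i
      fin_cases i <;> assumption
    · intro u v
      simp only [LinearMap.mk₂_apply, hA0, zero_smul, sub_zero, zero_mul, mul_zero, add_zero]
      have ht : ∀ w : Amb, IsTangent 0 p (w - w 0 • p) := fun w => by simp [IsTangent, hp0]
      have := h.form_generator_add hp (ht u) (ht v)
      rw [← hA] at this
      simp only [map_sub, map_smul, hAp, smul_zero, sub_zero] at this
      linarith
    · intro u v hu hv
      simp [hu rfl, hv rfl]
  · refine ⟨LinearMap.mk₂ ℝ (form ρ) (form_add_left ρ) (form_smul_left ρ) (form_add_right ρ)
      (form_smul_right ρ), form_comm ρ, ?_, ?_, fun _ _ _ _ => rfl, fun _ h => absurd h hρ⟩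
    · intro u hu
      simp only [LinearMap.mk₂_apply] at hu
      funext i
      have := hu (Pi.single i 1)
      fin_cases i <;> simpa [form, hρ] using this
    · intro u v
      have h1 := h.form_generator_self hρ (u + v)
      simp only [_root_.map_add, form_add_left, form_add_right, h.form_generator_self hρ] at h1
      simp only [LinearMap.mk₂_apply]
      rw [form_comm ρ u]
      linear_combination h1

/-- The fixed plane of a nontrivial group of rotations is the whole kernel of the generator: a
skew endomorphism of a four-dimensional space that kills a hyperplane is zero. -/
lemma generator_apply_ne_zero (h : IsRotationGroup ρ P φ) {W : Submodule ℝ Amb}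
    (hW : Module.finrank ℝ W = 3) (hPW : P ≤ W) {x : Amb} (hxW : x ∈ W) (hxP : x ∉ P) :
    deriv φ 0 x ≠ 0 := by
  obtain ⟨F, hsymm, hnd, hskew, -, -⟩ := h.exists_invariant_form
  set A := deriv φ 0 with hA
  intro hx
  have hAW : ∀ y ∈ W, A y = 0 := by
    intro y hy
    obtain ⟨t, ht⟩ := exists_sub_smul_mem hPW (by rw [hW, h.finrank_fixed]) hxW hxP hy
    have := h.generator_apply_fixed ht
    rwa [← hA, map_sub, map_smul, hx, smul_zero, sub_zero] at this
  have hWt : W ≠ ⊤ := by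
    rintro rfl
    simp at hW
  obtain ⟨z, -, hz⟩ := SetLike.exists_of_lt (lt_top_iff_ne_top.2 hWt)
  have hdec : ∀ y : Amb, ∃ t : ℝ, y - t • z ∈ W := fun y =>
    exists_sub_smul_mem le_top (by rw [hW]; simp) Submodule.mem_top hz (Submodule.mem_top (x := y))
  have hAz : A z = 0 := by
    refine hnd _ fun y => ?_
    obtain ⟨t, ht⟩ := hdec y
    have h1 : F (A z) (y - t • z) = 0 := by rw [hskew, hAW _ ht]; simp
    have h2 : F (A z) z = 0 := by
      have h3 := hskew z z
      rw [hsymm z] at h3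
      linarith
    simpa [h2] using h1
  refine h.generator_ne_zero (ContinuousLinearMap.ext fun y => ?_)
  obtain ⟨t, ht⟩ := hdec y
  have := hAW _ ht
  rwa [map_sub, map_smul, hAz, smul_zero, sub_zero] at this

/-- A hyperplane `W` through the fixed plane is mapped by the generator into a line, and is the
orthogonal complement of that line for the invariant form: the orbits meet `W` orthogonally, in a
constant direction. -/
lemma generator_meridian_plane (h : IsRotationGroup ρ P φ) {F : LinearMap.BilinForm ℝ Amb}
    (hsymm : ∀ u v, F u v = F v u) (hskew : ∀ u v, F (deriv φ 0 u) v = -F u (deriv φ 0 v))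
    {W : Submodule ℝ Amb} (hW : Module.finrank ℝ W = 3) (hPW : P ≤ W) {x : Amb} (hxW : x ∈ W)
    (hxP : x ∉ P) (hb : F (deriv φ 0 x) (deriv φ 0 x) ≠ 0) :
    (∀ y, F (deriv φ 0 x) y = 0 ↔ y ∈ W) ∧
    ∀ y ∈ W, F (deriv φ 0 x) (deriv φ 0 x) • deriv φ 0 y
      = F (deriv φ 0 y) (deriv φ 0 x) • deriv φ 0 x := by
  set A := deriv φ 0 with hA
  have hdecW : ∀ y ∈ W, ∃ t : ℝ, y - t • x ∈ P := fun y hy =>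
    exists_sub_smul_mem hPW (by rw [hW, h.finrank_fixed]) hxW hxP hy
  have hself : F (A x) x = 0 := by
    have h3 := hskew x x
    rw [hsymm x] at h3
    linarith
  have h1 : ∀ y ∈ W, F (A x) y = 0 := by
    intro y hy
    obtain ⟨t, ht⟩ := hdecW y hy
    have : F (A x) (y - t • x) = 0 := by
      rw [hskew, hA, h.generator_apply_fixed ht]; simp
    simpa [hself] using this
  refine ⟨fun y => ⟨fun hy => ?_, h1 y⟩, fun y hy => ?_⟩
  · by_contra hyW
    obtain ⟨t, ht⟩ := exists_sub_smul_mem (le_top : W ≤ ⊤) (by rw [hW]; simp)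
      Submodule.mem_top hyW (Submodule.mem_top (x := A x))
    have := h1 _ ht
    rw [map_sub, map_smul, hy, smul_zero, sub_zero] at this
    exact hb this
  · obtain ⟨t, ht⟩ := hdecW y hy
    have h2 := h.generator_apply_fixed ht
    rw [← hA, map_sub, map_smul, sub_eq_zero] at h2
    rw [h2, map_smul, LinearMap.smul_apply, smul_smul, smul_eq_mul, mul_comm]

end IsRotationGroup

/-! ### Derivatives of maps from a surface along curves -/

section Chart

variable {S : Type*} [TopologicalSpace S] [ChartedSpace (EuclideanSpace ℝ (Fin 2)) S]

/-- The curve through `p` which is a straight line with velocity `v` in the preferred chart. -/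
noncomputable def chartLine (p : S) (v : EuclideanSpace ℝ (Fin 2)) (t : ℝ) : S :=
  (extChartAt (𝓡 2) p).symm (extChartAt (𝓡 2) p p + t • v)

lemma chartLine_zero (p : S) (v : EuclideanSpace ℝ (Fin 2)) : chartLine p v 0 = p := by
  rw [chartLine, zero_smul, add_zero, extChartAt_to_inv]

variable {g : S → Amb}

lemma contDiffAt_comp_chartLine (hg : ContMDiff (𝓡 2) 𝓘(ℝ, Amb) ∞ g) (p : S)
    (v : EuclideanSpace ℝ (Fin 2)) : ContDiffAt ℝ ∞ (fun t => g (chartLine p v t)) 0 := by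
  have h1 : ContDiffAt ℝ ∞ (g ∘ (extChartAt (𝓡 2) p).symm)
      (extChartAt (𝓡 2) p p + (0 : ℝ) • v) := by
    have := (contMDiffAt_iff.1 (hg p)).2
    rw [ModelWithCorners.range_eq_univ] at this
    rw [zero_smul, add_zero]
    exact contDiffWithinAt_univ.1 this
  have h2 : ContDiffAt ℝ ∞ (fun t : ℝ => extChartAt (𝓡 2) p p + t • v) 0 := by fun_prop
  exact ContDiffAt.comp (g := g ∘ (extChartAt (𝓡 2) p).symm) (0 : ℝ) h1 h2

lemma hasDerivAt_comp_chartLine (hg : ContMDiff (𝓡 2) 𝓘(ℝ, Amb) ∞ g) (p : S)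
    (v : EuclideanSpace ℝ (Fin 2)) :
    HasDerivAt (fun t => g (chartLine p v t)) (diffl g p v) 0 := by
  have h0 : MDifferentiableAt (𝓡 2) 𝓘(ℝ, Amb) g p := (hg p).mdifferentiableAt (by simp)
  have h1 : HasFDerivAt (g ∘ (extChartAt (𝓡 2) p).symm) (diffl g p)
      (extChartAt (𝓡 2) p p + (0 : ℝ) • v) := by
    have := h0.hasMFDerivAt.2
    rw [ModelWithCorners.range_eq_univ] at this
    rw [zero_smul, add_zero]
    exact hasFDerivWithinAt_univ.1 this
  have h2 : HasDerivAt (fun t : ℝ => extChartAt (𝓡 2) p p + t • v) v 0 := by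
    simpa using ((hasDerivAt_id (0 : ℝ)).smul_const v).const_add (extChartAt (𝓡 2) p p)
  exact h1.comp_hasDerivAt (0 : ℝ) h2

lemma hasDerivAt_comp_of_mdifferentiableAt (hg : ContMDiff (𝓡 2) 𝓘(ℝ, Amb) ∞ g) {δ : ℝ → S}
    {s : ℝ} (hδ : MDifferentiableAt 𝓘(ℝ, ℝ) (𝓡 2) δ s) :
    HasDerivAt (fun t => g (δ t)) (diffl g (δ s) (mfderiv 𝓘(ℝ, ℝ) (𝓡 2) δ s (1 : ℝ))) s := by
  have h0 : MDifferentiableAt (𝓡 2) 𝓘(ℝ, Amb) g (δ s) := (hg _).mdifferentiableAt (by simp)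
  have h1 := h0.hasMFDerivAt.comp s hδ.hasMFDerivAt
  have h2 : HasFDerivAt (g ∘ δ)
      ((diffl g (δ s)).comp (mfderiv 𝓘(ℝ, ℝ) (𝓡 2) δ s) : ℝ →L[ℝ] Amb) s :=
    hasMFDerivAt_iff_hasFDerivAt.1 h1
  exact h2.hasDerivAt

end Chart

/-! ### Rotational surfaces -/

namespace OrientedSurface

variable {S : Type*} [TopologicalSpace S] [ChartedSpace (EuclideanSpace ℝ (Fin 2)) S]
variable {ρ : ℝ} {P : Submodule ℝ Amb} {φ : ℝ → Amb →L[ℝ] Amb} (X : OrientedSurface S ρ)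

lemma isTangent_diffl (p : S) (v : EuclideanSpace ℝ (Fin 2)) :
    IsTangent ρ (X.pos p) (diffl X.pos p v) := by
  have h1 := hasDerivAt_comp_chartLine X.pos_smooth p v
  have h2 := hasDerivAt_tangForm (ρ := ρ) h1 h1
  have := h2.unique ((hasDerivAt_const (0 : ℝ) (1 : ℝ)).congr_of_eventuallyEq
    (.of_forall fun t => tangForm_self (X.pos_mem _)))
  rw [chartLine_zero, tangForm_comm] at this
  rw [isTangent_iff]; linarith

variable {X}

lemma IsInvariant.exists_diffl_eq (hX : X.IsInvariant φ) (h : IsRotationGroup ρ P φ) (p : S) :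
    ∃ V : EuclideanSpace ℝ (Fin 2), diffl X.pos p V = deriv φ 0 (X.pos p) := by
  obtain ⟨o, ho, rfl, hpos⟩ := hX p
  refine ⟨_, (hasDerivAt_comp_of_mdifferentiableAt X.pos_smooth
    (ho.mdifferentiable (by simp) 0)).unique ?_⟩
  exact (h.hasDerivAt_apply _).congr_of_eventuallyEq (.of_forall hpos)

lemma IsInvariant.form_generator_nor (hX : X.IsInvariant φ) (h : IsRotationGroup ρ P φ) (p : S) :
    form ρ (deriv φ 0 (X.pos p)) (X.nor p) = 0 := by
  obtain ⟨V, hV⟩ := hX.exists_diffl_eq h p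
  rw [← hV, form_comm]
  exact X.nor_orth p V

lemma IsInvariant.form_generator_diffl (hX : X.IsInvariant φ) (h : IsRotationGroup ρ P φ) (p : S)
    (v : EuclideanSpace ℝ (Fin 2)) :
    form ρ (deriv φ 0 (diffl X.pos p v)) (X.nor p)
      + form ρ (deriv φ 0 (X.pos p)) (diffl X.nor p v) = 0 := by
  have h1 := ((deriv φ 0).hasFDerivAt.comp_hasDerivAt (0 : ℝ)
    (hasDerivAt_comp_chartLine X.pos_smooth p v))
  have h2 := hasDerivAt_form (ρ := ρ) h1 (hasDerivAt_comp_chartLine X.nor_smooth p v)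
  simp only [Function.comp_apply, hX.form_generator_nor h] at h2
  have := h2.unique (hasDerivAt_const 0 0)
  rwa [chartLine_zero] at this

/-- Second derivative of `⟨ξ, η⟩ = 0`, for the Killing field `ξ` of the rotations, at a point where
`ξ` vanishes and the generator kills the normal. -/
lemma IsInvariant.form_generator_diffl_diffl (hX : X.IsInvariant φ) (h : IsRotationGroup ρ P φ)
    {p : S} (h0 : deriv φ 0 (X.pos p) = 0)
    (hn : ∀ y, form ρ (deriv φ 0 y) (X.nor p) = 0) (v : EuclideanSpace ℝ (Fin 2)) :
    form ρ (deriv φ 0 (diffl X.pos p v)) (diffl X.nor p v) = 0 := by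
  set A := deriv φ 0
  set G : ℝ → Amb := fun t => X.pos (chartLine p v t) with hG
  set N : ℝ → Amb := fun t => X.nor (chartLine p v t) with hN
  have hGs : ContDiffAt ℝ ∞ G 0 := contDiffAt_comp_chartLine X.pos_smooth p v
  have hNs : ContDiffAt ℝ ∞ N 0 := contDiffAt_comp_chartLine X.nor_smooth p v
  have hd : ∀ {f : ℝ → Amb}, ContDiffAt ℝ ∞ f 0 → ∀ᶠ t in nhds 0, HasDerivAt f (deriv f t) t := by
    intro f hf
    have : ContDiffAt ℝ 1 f 0 := hf.of_le (by exact_mod_cast le_top)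
    filter_upwards [this.eventually (by simp)] with t ht
    exact (ht.differentiableAt (by simp)).hasDerivAt
  have hdd : ∀ {f : ℝ → Amb}, ContDiffAt ℝ ∞ f 0 →
      HasDerivAt (deriv f) (deriv (deriv f) 0) 0 := by
    intro f hf
    have : ContDiffAt ℝ ∞ (deriv f) 0 := hf.derivWithin le_rfl
    exact (this.differentiableAt (by simp)).hasDerivAt
  have hA : ∀ {f : ℝ → Amb} {f' : Amb} {t : ℝ}, HasDerivAt f f' t →
      HasDerivAt (fun t => A (f t)) (A f') t := fun hf => A.hasFDerivAt.comp_hasDerivAt _ hf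
  have hzero : ∀ t, form ρ (A (G t)) (N t) = 0 := fun t => hX.form_generator_nor h _
  have h1 : ∀ᶠ t in nhds 0, form ρ (A (deriv G t)) (N t) + form ρ (A (G t)) (deriv N t) = 0 := by
    filter_upwards [hd hGs, hd hNs] with t hGt hNt
    have := hasDerivAt_form (ρ := ρ) (hA hGt) hNt
    simp only [hzero] at this
    exact this.unique (hasDerivAt_const t 0)
  have h2 := (hasDerivAt_form (ρ := ρ) (hA (hdd hGs)) (hd hNs).self_of_nhds).add
    (hasDerivAt_form (ρ := ρ) (hA (hd hGs).self_of_nhds) (hdd hNs))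
  have h3 := h2.unique ((hasDerivAt_const (0 : ℝ) (0 : ℝ)).congr_of_eventuallyEq h1)
  have hG0 : G 0 = X.pos p := by rw [hG]; simp only [chartLine_zero]
  have hN0 : N 0 = X.nor p := by rw [hN]; simp only [chartLine_zero]
  have hG1 : deriv G 0 = diffl X.pos p v := (hasDerivAt_comp_chartLine X.pos_smooth p v).deriv
  have hN1 : deriv N 0 = diffl X.nor p v := (hasDerivAt_comp_chartLine X.nor_smooth p v).deriv
  rw [hG0, hN0, hG1, hN1, h0, hn] at h3
  have : form ρ 0 (deriv (deriv N) 0) = 0 := by simp [form]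
  linarith

/-- Principal directions, read off in the ambient space, as an orthonormal frame. -/
lemma HasPrincipalCurvatures.exists_frame {p : S} {k₁ k₂ : ℝ}
    (hk : X.HasPrincipalCurvatures p k₁ k₂) :
    ∃ t₁ t₂ : Amb, form ρ t₁ t₁ = 1 ∧ form ρ t₂ t₂ = 1 ∧ form ρ t₁ t₂ = 0 ∧
      (∀ v : EuclideanSpace ℝ (Fin 2), ∃ a b : ℝ, diffl X.pos p v = a • t₁ + b • t₂ ∧
        diffl X.nor p v = (-(k₁ * a)) • t₁ + (-(k₂ * b)) • t₂) ∧
      ∀ a b : ℝ, ∃ v : EuclideanSpace ℝ (Fin 2), diffl X.pos p v = a • t₁ + b • t₂ ∧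
        diffl X.nor p v = (-(k₁ * a)) • t₁ + (-(k₂ * b)) • t₂ := by
  obtain ⟨e₁, e₂, h1, h2, h12, d1, d2⟩ := hk
  have hcomb : ∀ a b : ℝ, diffl X.pos p (a • e₁ + b • e₂)
        = a • diffl X.pos p e₁ + b • diffl X.pos p e₂ ∧
      diffl X.nor p (a • e₁ + b • e₂)
        = (-(k₁ * a)) • diffl X.pos p e₁ + (-(k₂ * b)) • diffl X.pos p e₂ := by
    intro a b
    constructor
    · rw [map_add, map_smul, map_smul]
    · rw [map_add, map_smul, map_smul, d1, d2]
      module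
  refine ⟨_, _, h1, h2, h12, fun v => ?_, fun a b => ⟨_, hcomb a b⟩⟩
  let f₁ : EuclideanSpace ℝ (Fin 2) := e₁
  let f₂ : EuclideanSpace ℝ (Fin 2) := e₂
  have hli : LinearIndependent ℝ ![f₁, f₂] := by
    rw [LinearIndependent.pair_iff]
    intro a b hab
    have h0 : a • diffl X.pos p e₁ + b • diffl X.pos p e₂ = 0 := by
      rw [← (hcomb a b).1]
      exact (congrArg (diffl X.pos p) hab).trans (map_zero _)
    have key : ∀ t, a * form ρ (diffl X.pos p e₁) t + b * form ρ (diffl X.pos p e₂) t = 0 := by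
      intro t
      rw [← form_smul_left, ← form_smul_left, ← form_add_left, h0]
      simp [form]
    have k1 := key (diffl X.pos p e₁)
    have k2 := key (diffl X.pos p e₂)
    rw [form_comm ρ (diffl X.pos p e₂), h1, h12] at k1
    rw [h2, h12] at k2
    constructor <;> linarith
  have hspan := hli.span_eq_top_of_card_eq_finrank' (by simp)
  have hv : v ∈ Submodule.span ℝ (Set.range ![f₁, f₂]) := hspan ▸ Submodule.mem_top
  obtain ⟨g, hg⟩ := (Submodule.mem_span_range_iff_exists_fun ℝ).1 hv
  rw [Fin.sum_univ_two] at hg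
  refine ⟨g 0, g 1, ?_⟩
  rw [← hg]
  exact hcomb (g 0) (g 1)

lemma isTangent_of_frame {p : S} {k₁ k₂ : ℝ} {t₁ t₂ : Amb}
    (ht : ∀ a b : ℝ, ∃ v : EuclideanSpace ℝ (Fin 2), diffl X.pos p v = a • t₁ + b • t₂ ∧
        diffl X.nor p v = (-(k₁ * a)) • t₁ + (-(k₂ * b)) • t₂) :
    (IsTangent ρ (X.pos p) t₁ ∧ form ρ (X.nor p) t₁ = 0) ∧
      IsTangent ρ (X.pos p) t₂ ∧ form ρ (X.nor p) t₂ = 0 := by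
  obtain ⟨v, hv, -⟩ := ht 1 0
  obtain ⟨w, hw, -⟩ := ht 0 1
  simp only [one_smul, zero_smul, zero_add, add_zero] at hv hw
  rw [← hv, ← hw]
  exact ⟨⟨X.isTangent_diffl p v, X.nor_orth p v⟩, X.isTangent_diffl p w, X.nor_orth p w⟩

/-- A rotational surface is umbilic where it meets the axis: there the normal is tangent to the axis
and the shape operator commutes with the rotations of the tangent plane. -/
lemma IsInvariant.pos_notMem_fixed (hX : X.IsInvariant φ) (h : IsRotationGroup ρ P φ) {p : S}
    {k₁ k₂ : ℝ} (hk : X.HasPrincipalCurvatures p k₁ k₂) (hne : k₁ ≠ k₂) : X.pos p ∉ P := by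
  intro hP
  obtain ⟨F, hsymm, hnd, hskew, hF, hA0⟩ := h.exists_invariant_form
  have hx := h.generator_apply_fixed hP
  obtain ⟨t₁, t₂, h11, h22, h12, -, ht⟩ := hk.exists_frame
  obtain ⟨⟨T1, n1⟩, T2, n2⟩ := isTangent_of_frame ht
  have hAn0 := hX.form_generator_diffl h p
  have hsec := hX.form_generator_diffl_diffl h (p := p) hx
  set A := deriv φ 0 with hA
  set n := X.nor p with hn
  have hD : ∀ {v}, IsTangent ρ (X.pos p) v → ρ = 0 → v 0 = 0 :=
    fun hv => hv.zero_of_flat (X.pos_mem p)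
  have hFA : ∀ u {v}, IsTangent ρ (X.pos p) v → F (A u) v = form ρ (A u) v :=
    fun u v hv => hF _ _ (hA0 u) (hD hv)
  have hself : ∀ u, F (A u) u = 0 := by
    intro u
    have h3 := hskew u u
    rw [hsymm u] at h3
    linarith
  have hbasis : ∀ y, ∃ a b₁ b₂ b₃ : ℝ, y = a • X.pos p + b₁ • t₁ + b₂ • t₂ + b₃ • n :=
    exists_eq_add_of_orthogonal (X.pos_mem p) T1 T2 (X.nor_tangent p) (by simp [h11])
      (by simp [h22]) (by simp [hn, X.nor_unit p]) h12 (by rw [form_comm]; exact n1)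
      (by rw [form_comm]; exact n2)
  have hvanish : ∀ u, F (A u) t₁ = 0 → F (A u) t₂ = 0 → F (A u) n = 0 → A u = 0 := by
    intro u e1 e2 e3
    refine hnd _ fun y => ?_
    obtain ⟨a, b₁, b₂, b₃, rfl⟩ := hbasis y
    have e0 : F (A u) (X.pos p) = 0 := by rw [hskew, hx]; simp
    simp [e0, e1, e2, e3]
  have hAt : ∀ a b : ℝ, F (A (a • t₁ + b • t₂)) n = 0 := by
    intro a b
    obtain ⟨v, hv, -⟩ := ht a b
    have := hAn0 v
    rw [hx, hv] at this
    rw [hFA _ (X.nor_tangent p)]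
    simpa [form] using this
  have a1 : F (A t₁) n = 0 := by simpa using hAt 1 0
  have a2 : F (A t₂) n = 0 := by simpa using hAt 0 1
  -- The first derivative of `⟨ξ, η⟩ = 0` says that the normal is tangent to the axis.
  have hAn : A n = 0 := by
    refine hvanish n ?_ ?_ (hself n)
    · rw [hskew, hsymm, a1, neg_zero]
    · rw [hskew, hsymm, a2, neg_zero]
  -- The second derivative, in the direction `t₁ + t₂`, is `(k₁ - k₂) ⟨A t₁, t₂⟩`.
  have hlam : F (A t₁) t₂ = 0 := by
    obtain ⟨v, hv, hv'⟩ := ht 1 1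
    have h1 := hsec (fun y => by
      rw [← hFA _ (X.nor_tangent p), hskew, hAn]; simp) v
    have ht21 : F (A t₂) t₁ = -F (A t₁) t₂ := by rw [hskew, hsymm]
    rw [hv, hv', ← hFA _ ((T1.smul _).add (T2.smul _))] at h1
    simp only [one_smul, mul_one, _root_.map_add, map_smul, LinearMap.add_apply, hself, ht21,
      smul_eq_mul] at h1
    have h2 : (k₁ - k₂) * F (A t₁) t₂ = 0 := by linear_combination h1
    exact (mul_eq_zero.1 h2).resolve_left (sub_ne_zero.2 hne)
  have hA1 : A t₁ = 0 := hvanish _ (hself _) hlam a1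
  have hA2 : A t₂ = 0 := hvanish _ (by rw [hskew, hsymm, hlam, neg_zero]) (hself _) a2
  refine h.generator_ne_zero (ContinuousLinearMap.ext fun y => ?_)
  obtain ⟨a, b₁, b₂, b₃, rfl⟩ := hbasis y
  rw [← hA]
  simp [hx, hA1, hA2, hAn]

end OrientedSurface

/-! ### Profile curves -/

/-- For an orthogonal pair of tangent vectors, the first of unit length and the second nonzero, and a
diagonal operator taking the first to a vector orthogonal to the second, both are eigenvectors. -/
lemma eigen_of_orthogonal {a₁ a₂ b₁ b₂ k₁ k₂ : ℝ} (ha : a₁ ^ 2 + a₂ ^ 2 = 1)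
    (hb : b₁ ^ 2 + b₂ ^ 2 ≠ 0) (hab : a₁ * b₁ + a₂ * b₂ = 0)
    (hk : k₁ * a₁ * b₁ + k₂ * a₂ * b₂ = 0) (hne : k₁ ≠ k₂) :
    (a₁ = 0 ∧ b₂ = 0) ∨ (a₂ = 0 ∧ b₁ = 0) := by
  have h1 : (k₁ - k₂) * (a₁ * b₁) = 0 := by linear_combination hk - k₂ * hab
  have h2 : a₁ * b₁ = 0 := (mul_eq_zero.1 h1).resolve_left (sub_ne_zero.2 hne)
  have h3 : a₂ * b₂ = 0 := by linarith
  rcases mul_eq_zero.1 h2 with h | h <;> rcases mul_eq_zero.1 h3 with h' | h'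
  · simp [h, h'] at ha
  · exact Or.inl ⟨h, h'⟩
  · exact Or.inr ⟨h', h⟩
  · simp [h, h'] at hb

section ProfileCurve

variable {S : Type*} [TopologicalSpace S] [ChartedSpace (EuclideanSpace ℝ (Fin 2)) S]
variable {ρ : ℝ} {P : Submodule ℝ Amb} {φ : ℝ → Amb →L[ℝ] Amb} {X : OrientedSurface S ρ}

/-- On a rotational surface without umbilics, a unit tangent vector `u` orthogonal to the orbit is
principal as soon as the derivative of the normal along `u` is orthogonal to the orbit too; the orbit
then has the other principal direction. -/
lemma OrientedSurface.HasPrincipalCurvatures.principal_of_orthogonal {p : S} {k₁ k₂ : ℝ}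
    (hk : X.HasPrincipalCurvatures p k₁ k₂) (hne : k₁ ≠ k₂) {u V : EuclideanSpace ℝ (Fin 2)}
    (hu : form ρ (diffl X.pos p u) (diffl X.pos p u) = 1) (hV : diffl X.pos p V ≠ 0)
    (huV : form ρ (diffl X.pos p u) (diffl X.pos p V) = 0)
    (hnV : form ρ (diffl X.nor p u) (diffl X.pos p V) = 0) :
    form ρ (diffl X.pos p V) (diffl X.pos p V) ≠ 0 ∧
    ∃ k l : ℝ, (k = k₁ ∧ l = k₂ ∨ k = k₂ ∧ l = k₁) ∧
      diffl X.nor p u = -(k • diffl X.pos p u) ∧ diffl X.nor p V = -(l • diffl X.pos p V) := by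
  obtain ⟨t₁, t₂, h11, h22, h12, ht, -⟩ := hk.exists_frame
  obtain ⟨a₁, a₂, hu1, hu2⟩ := ht u
  obtain ⟨b₁, b₂, hV1, hV2⟩ := ht V
  have h21 : form ρ t₂ t₁ = 0 := by rw [form_comm, h12]
  have hexp : ∀ x₁ x₂ y₁ y₂ : ℝ,
      form ρ (x₁ • t₁ + x₂ • t₂) (y₁ • t₁ + y₂ • t₂) = x₁ * y₁ + x₂ * y₂ := by
    intro x₁ x₂ y₁ y₂
    simp only [form_add_left, form_add_right, form_smul_left, form_smul_right, h11, h22, h12, h21]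
    ring
  rw [hu1, hexp] at hu
  rw [hu1, hV1, hexp] at huV
  rw [hu2, hV1, hexp] at hnV
  have hb : b₁ ^ 2 + b₂ ^ 2 ≠ 0 := by
    intro h0
    have e1 : b₁ = 0 := by nlinarith [sq_nonneg b₁, sq_nonneg b₂]
    have e2 : b₂ = 0 := by nlinarith [sq_nonneg b₁, sq_nonneg b₂]
    exact hV (by simp [hV1, e1, e2])
  refine ⟨by rw [hV1, hexp]; simpa [sq] using hb, ?_⟩
  rcases eigen_of_orthogonal (by linarith) hb huV (by linarith) hne with ⟨rfl, rfl⟩ | ⟨rfl, rfl⟩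
  · refine ⟨k₂, k₁, Or.inr ⟨rfl, rfl⟩, ?_, ?_⟩
    · rw [hu2, hu1]; module
    · rw [hV2, hV1]; module
  · refine ⟨k₁, k₂, Or.inl ⟨rfl, rfl⟩, ?_, ?_⟩
    · rw [hu2, hu1]; module
    · rw [hV2, hV1]; module

/-- The structure of a profile curve `x` of a rotational surface without umbilics. There is a
linear functional `ℓ` (the coordinate of the generator along the constant direction of the orbits)
such that, with `k` and `l` the principal curvatures of the profile and of the orbit,
`l ℓ(x) = -ℓ(η)`, `η' = -k x'` and `x'' + ρ x = k η`. -/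
lemma OrientedSurface.IsProfileCurve.exists_structure {I : Set ℝ} {γ : ℝ → S}
    (hγ : X.IsProfileCurve P I γ) (hX : X.IsInvariant φ) (h : IsRotationGroup ρ P φ)
    {κ₁ κ₂ : S → ℝ} (hκ : ∀ p, X.HasPrincipalCurvatures p (κ₁ p) (κ₂ p))
    (hne : ∀ p, κ₁ p ≠ κ₂ p) (hIo : IsOpen I) (hI : I.Nonempty) :
    ∃ ℓ : Amb →L[ℝ] ℝ, ∀ s ∈ I, ∃ k l : ℝ,
      (k = κ₁ (γ s) ∧ l = κ₂ (γ s) ∨ k = κ₂ (γ s) ∧ l = κ₁ (γ s)) ∧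
      form ρ (deriv (deriv fun u => X.pos (γ u)) s) (X.nor (γ s)) = k ∧
      ℓ (X.pos (γ s)) ≠ 0 ∧ l * ℓ (X.pos (γ s)) = -ℓ (X.nor (γ s)) ∧
      HasDerivAt (fun u => X.pos (γ u)) (deriv (fun u => X.pos (γ u)) s) s ∧
      HasDerivAt (deriv fun u => X.pos (γ u)) (deriv (deriv fun u => X.pos (γ u)) s) s ∧
      HasDerivAt (fun u => X.nor (γ u)) (-(k • deriv (fun u => X.pos (γ u)) s)) s ∧
      deriv (deriv fun u => X.pos (γ u)) s + ρ • X.pos (γ s) = k • X.nor (γ s) := by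
  obtain ⟨W, hW, hPW, hxW⟩ := hγ.planar
  obtain ⟨F, hsymm, -, hskew, hF, hA0⟩ := h.exists_invariant_form
  -- The direction `b` of the orbits along the curve is taken at an arbitrary parameter `s₀`.
  obtain ⟨s₀, hs₀⟩ := hI
  have hgen := hX.form_generator_diffl h
  have hgn := hX.form_generator_nor h
  have hex := hX.exists_diffl_eq h
  have hAne : ∀ s ∈ I, deriv φ 0 (X.pos (γ s)) ≠ 0 := fun s hs =>
    h.generator_apply_ne_zero hW hPW (hxW s hs) (hX.pos_notMem_fixed h (hκ _) (hne _))
  have hmer := h.generator_meridian_plane hsymm hskew hW hPW (hxW s₀ hs₀)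
    (hX.pos_notMem_fixed h (hκ _) (hne _))
  set A := deriv φ 0 with hA
  set b := A (X.pos (γ s₀)) with hb
  set x : ℝ → Amb := fun u => X.pos (γ u) with hx
  have hDt : ∀ {s v}, IsTangent ρ (x s) v → ρ = 0 → v 0 = 0 :=
    fun {s} {v} hv => hv.zero_of_flat (X.pos_mem (γ s))
  have hxs : ContDiffOn ℝ ∞ x I := by
    have : ContMDiffOn 𝓘(ℝ, ℝ) 𝓘(ℝ, Amb) ∞ x I := X.pos_smooth.comp_contMDiffOn hγ.smooth
    exact contMDiffOn_iff_contDiffOn.1 this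
  have hx's : ContDiffOn ℝ ∞ (deriv x) I := hxs.deriv_of_isOpen hIo le_rfl
  have hd1 : ∀ s ∈ I, HasDerivAt x (deriv x s) s := fun s hs =>
    ((hxs.differentiableOn (by simp)).differentiableAt (hIo.mem_nhds hs)).hasDerivAt
  have hd2 : ∀ s ∈ I, HasDerivAt (deriv x) (deriv (deriv x) s) s := fun s hs =>
    ((hx's.differentiableOn (by simp)).differentiableAt (hIo.mem_nhds hs)).hasDerivAt
  have hγd : ∀ s ∈ I, MDifferentiableAt 𝓘(ℝ, ℝ) (𝓡 2) γ s := fun s hs =>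
    (hγ.smooth.contMDiffAt (hIo.mem_nhds hs)).mdifferentiableAt (by simp)
  have hu : ∀ s ∈ I, ∃ u : EuclideanSpace ℝ (Fin 2), deriv x s = diffl X.pos (γ s) u ∧
      HasDerivAt (fun u => X.nor (γ u)) (diffl X.nor (γ s) u) s := fun s hs =>
    ⟨_, (hd1 s hs).unique (hasDerivAt_comp_of_mdifferentiableAt X.pos_smooth (hγd s hs)),
      hasDerivAt_comp_of_mdifferentiableAt X.nor_smooth (hγd s hs)⟩
  have hmem : ∀ {f : ℝ → ℝ} {f' : ℝ} {s : ℝ}, s ∈ I → (∀ t ∈ I, f t = 0) → HasDerivAt f f' s →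
      f' = 0 := by
    intro f f' s hs hf hf'
    refine hf'.unique ((hasDerivAt_const s (0 : ℝ)).congr_of_eventuallyEq ?_)
    filter_upwards [hIo.mem_nhds hs] with t ht using hf t ht
  have hlin : ∀ (G : Amb →ₗ[ℝ] ℝ) {f : ℝ → Amb} {f' : Amb} {s : ℝ}, HasDerivAt f f' s →
      HasDerivAt (fun t => G (f t)) (G f') s := fun G _ _ _ hf =>
    G.toContinuousLinearMap.hasFDerivAt.comp_hasDerivAt _ hf
  -- The orbit direction `b` is non-null because it is a nonzero tangent vector of the surface.
  have hbb : F b b ≠ 0 := by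
    obtain ⟨V, hV⟩ := hex (γ s₀)
    obtain ⟨t₁, t₂, h11, h22, h12, ht, -⟩ := (hκ (γ s₀)).exists_frame
    obtain ⟨b₁, b₂, hV1, -⟩ := ht V
    rw [hF b b (hA0 _) (hA0 _), hb, ← hV, hV1]
    simp only [form_add_left, form_add_right, form_smul_left, form_smul_right, h11, h22, h12,
      form_comm ρ t₂ t₁]
    intro h0
    have e1 : b₁ = 0 := by nlinarith [sq_nonneg b₁, sq_nonneg b₂]
    have e2 : b₂ = 0 := by nlinarith [sq_nonneg b₁, sq_nonneg b₂]
    refine hAne s₀ hs₀ ?_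
    rw [← hV, hV1, e1, e2]
    simp
  obtain ⟨hbW, hAW⟩ := hmer hbb
  set ℓ : Amb →ₗ[ℝ] ℝ := (F.flip b).comp (A : Amb →ₗ[ℝ] Amb) with hℓ
  have hAℓ : ∀ y ∈ W, F b b • A y = ℓ y • b := hAW
  have hx'W : ∀ s ∈ I, deriv x s ∈ W := fun s hs =>
    (hbW _).1 (hmem hs (fun t ht => (hbW _).2 (hxW t ht)) (hlin (F b) (hd1 s hs)))
  have hx''W : ∀ s ∈ I, deriv (deriv x) s ∈ W := fun s hs =>
    (hbW _).1 (hmem hs (fun t ht => (hbW _).2 (hx'W t ht)) (hlin (F b) (hd2 s hs)))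
  have hℓ0 : ∀ s ∈ I, ℓ (x s) ≠ 0 := by
    intro s hs h0
    have := hAℓ _ (hxW s hs)
    rw [show ℓ (X.pos (γ s)) = 0 from h0, zero_smul] at this
    exact hAne s hs ((smul_eq_zero.1 this).resolve_left hbb)
  have horb : ∀ s ∈ I, ∀ y, F (A (x s)) y = 0 ↔ y ∈ W := by
    intro s hs y
    rw [← hbW]
    have e : F b b * F (A (x s)) y = ℓ (x s) * F b y := by
      have := congrArg (fun z => F z y) (hAℓ _ (hxW s hs))
      simpa using this
    constructor
    · intro h0
      rw [h0, mul_zero] at e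
      exact (mul_eq_zero.1 e.symm).resolve_left (hℓ0 s hs)
    · intro h0
      rw [h0, mul_zero] at e
      exact (mul_eq_zero.1 e).resolve_left hbb
  have hnW : ∀ s ∈ I, X.nor (γ s) ∈ W := fun s hs => by
    rw [← horb s hs, hF _ _ (hA0 _) (hDt (s := s) (X.nor_tangent _))]
    exact hgn (γ s)
  have hx'T : ∀ s ∈ I, IsTangent ρ (x s) (deriv x s) := by
    intro s hs
    obtain ⟨u, hu, -⟩ := hu s hs
    rw [hu]; exact X.isTangent_diffl _ _
  refine ⟨ℓ.toContinuousLinearMap, fun s hs => ?_⟩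
  obtain ⟨u, hu1, hu2⟩ := hu s hs
  obtain ⟨V, hV⟩ := hex (γ s)
  have hn'W : diffl X.nor (γ s) u ∈ W :=
    (hbW _).1 (hmem hs (fun t ht => (hbW _).2 (hnW t ht)) (hlin (F b) hu2))
  have hξT : IsTangent ρ (x s) (A (x s)) := h.isTangent_generator (X.pos_mem _)
  obtain ⟨hVV, k, l, hkl, hk, hl⟩ :=
    (hκ (γ s)).principal_of_orthogonal (hne _) (u := u) (V := V)
    (by rw [← hu1]; exact hγ.unit_speed s hs) (by rw [hV]; exact hAne s hs)
    (by
      rw [hV, ← hu1, ← hF _ _ (hDt (hx'T s hs)) (hA0 _), hsymm]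
      exact (horb s hs _).2 (hx'W s hs))
    (by
      have hn'D : ρ = 0 → diffl X.nor (γ s) u 0 = 0 := fun h0 => by
        have h1 := hasDerivAt_pi.1 hu2 0
        exact hmem hs (fun t ht => (X.nor_tangent (γ t)).zero_of_flat (X.pos_mem _) h0) h1
      rw [hV, ← hF _ _ hn'D (hA0 _), hsymm]
      exact (horb s hs _).2 hn'W)
  rw [hV] at hVV hl
  rw [← hu1] at hk
  rw [hk] at hu2
  have hxn : ∀ t ∈ I, form ρ (deriv x t) (X.nor (γ t)) = 0 := by
    intro t ht
    obtain ⟨u, hu, -⟩ := hu t ht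
    rw [hu, form_comm]; exact X.nor_orth _ _
  have hunit := hγ.unit_speed s hs
  have hkform : form ρ (deriv (deriv x) s) (X.nor (γ s)) = k := by
    have := hmem hs hxn (hasDerivAt_form (hd2 s hs) hu2)
    rw [form_neg_right, form_smul_right, hunit] at this
    linarith
  refine ⟨k, l, hkl, hkform, hℓ0 s hs, ?_, hd1 s hs, hd2 s hs, hu2, ?_⟩
  · -- The curvature of the orbit, from the derivative of `⟨ξ, η⟩ = 0` along the orbit.
    have h1 := hgen (γ s) V
    rw [hV, hl, form_neg_right, form_smul_right,
      ← hF (A (A (X.pos (γ s)))) _ (hA0 _) (hDt (s := s) (X.nor_tangent _)), hskew,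
      ← hF (A (X.pos (γ s))) _ (hA0 _) (hA0 _)] at h1
    have e1 := hAℓ _ (hxW s hs)
    have e2 := hAℓ _ (hnW s hs)
    have h2 : F (F b b • A (X.pos (γ s))) (F b b • A (X.nor (γ s)))
        = -l * F (F b b • A (X.pos (γ s))) (F b b • A (X.pos (γ s))) := by
      simp only [map_smul, LinearMap.smul_apply, smul_eq_mul]
      linear_combination -(F b b) ^ 2 * h1
    rw [e1, e2] at h2
    simp only [map_smul, LinearMap.smul_apply, smul_eq_mul] at h2
    have h3 : ℓ (x s) * F b b * (l * ℓ (x s) + ℓ (X.nor (γ s))) = 0 := by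
      linear_combination h2
    have := (mul_eq_zero.1 h3).resolve_left (mul_ne_zero (hℓ0 s hs) hbb)
    exact eq_neg_of_add_eq_zero_left this
  · have hx'D := hDt (hx'T s hs)
    have hnT : IsTangent ρ (x s) (X.nor (γ s)) := X.nor_tangent (γ s)
    have hx'' : tangForm ρ (x s) (deriv (deriv x) s) = -ρ := by
      have := hmem hs (fun t ht => isTangent_iff.1 (hx'T t ht))
        (hasDerivAt_tangForm (hd1 s hs) (hd2 s hs))
      rw [tangForm_eq_mul_form hx'D, hunit] at this
      linarith
    have hx'x'' : form ρ (deriv (deriv x) s) (deriv x s) = 0 := by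
      have := hmem (f := fun t => form ρ (deriv x t) (deriv x t) - 1) hs
        (fun t ht => sub_eq_zero.2 (hγ.unit_speed t ht))
        ((hasDerivAt_form (hd2 s hs) (hd2 s hs)).sub_const 1)
      rw [form_comm ρ (deriv x s)] at this
      linarith
    have hρx : ∀ v, IsTangent ρ (x s) v → ρ * form ρ (x s) v = 0 := by
      intro v hv
      rw [form_comm, ← tangForm_eq_mul_form (hDt hv), tangForm_comm]
      exact hv
    have hzT : IsTangent ρ (x s) (deriv (deriv x) s + ρ • x s - k • X.nor (γ s)) := by
      have e : tangForm ρ (x s) (deriv (deriv x) s + ρ • x s - k • X.nor (γ s))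
          = tangForm ρ (x s) (deriv (deriv x) s) + ρ * tangForm ρ (x s) (x s)
            - k * tangForm ρ (x s) (X.nor (γ s)) := by
        simp only [tangForm, Pi.add_apply, Pi.sub_apply, Pi.smul_apply, smul_eq_mul]; ring
      rw [isTangent_iff, e, hx'', tangForm_self (X.pos_mem _), isTangent_iff.1 hnT]
      ring
    -- `z` is tangent and orthogonal to the frame `x'`, `ξ`, `η` of the tangent space.
    set z := deriv (deriv x) s + ρ • x s - k • X.nor (γ s) with hz
    have hzform : ∀ v, form ρ z v = form ρ (deriv (deriv x) s) v + ρ * form ρ (x s) v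
        - k * form ρ (X.nor (γ s)) v := by
      intro v
      rw [hz, sub_eq_add_neg, form_add_left, form_add_left, form_neg_left, form_smul_left,
        form_smul_left]
      ring
    have hzx' : form ρ z (deriv x s) = 0 := by
      rw [hzform, hx'x'', hρx _ (hx'T s hs), form_comm, hxn s hs]; ring
    have hzn : form ρ z (X.nor (γ s)) = 0 := by
      rw [hzform, hkform, hρx _ hnT, X.nor_unit]; ring
    have hzξ : form ρ z (A (x s)) = 0 := by
      rw [← hF _ _ (hDt hzT) (hA0 _), hsymm, horb s hs]
      exact W.sub_mem (W.add_mem (hx''W s hs) (W.smul_mem _ (hxW s hs))) (W.smul_mem _ (hnW s hs))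
    have hx'ξ : form ρ (deriv x s) (A (x s)) = 0 := by
      rw [← hF _ _ hx'D (hA0 _), hsymm, horb s hs]
      exact hx'W s hs
    obtain ⟨a, b₁, b₂, b₃, hdec⟩ := exists_eq_add_of_orthogonal (X.pos_mem (γ s)) (hx'T s hs) hξT
      hnT (by rw [hunit]; exact one_ne_zero) hVV (by rw [X.nor_unit]; exact one_ne_zero) hx'ξ
      (hxn s hs) (hgn (γ s)) z
    have ha : a = 0 := by
      have e : tangForm ρ (x s) (a • x s + b₁ • deriv x s + b₂ • A (x s) + b₃ • X.nor (γ s))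
          = a * tangForm ρ (x s) (x s) + b₁ * tangForm ρ (x s) (deriv x s)
            + b₂ * tangForm ρ (x s) (A (x s)) + b₃ * tangForm ρ (x s) (X.nor (γ s)) := by
        simp only [tangForm, Pi.add_apply, Pi.smul_apply, smul_eq_mul]; ring
      have e' : tangForm ρ (x s) z = 0 := hzT
      rw [hdec] at e'
      have := e.symm.trans e'
      rw [tangForm_self (X.pos_mem _), isTangent_iff.1 (hx'T s hs), isTangent_iff.1 hξT,
        isTangent_iff.1 hnT] at this
      linarith
    have key : ∀ v, form ρ z v = b₁ * form ρ (deriv x s) v + b₂ * form ρ (A (x s)) v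
        + b₃ * form ρ (X.nor (γ s)) v := by
      intro v
      rw [hdec, ha, zero_smul, zero_add, form_add_left, form_add_left, form_smul_left,
        form_smul_left, form_smul_left]
    have hgn' : form ρ (A (x s)) (X.nor (γ s)) = 0 := hgn (γ s)
    have c1 : b₁ = 0 := by
      have := key (deriv x s)
      rw [hzx', hunit, form_comm ρ (A (x s)), hx'ξ, form_comm ρ (X.nor (γ s)), hxn s hs] at this
      linarith
    have c2 : b₂ = 0 := by
      have := key (A (x s))
      rw [hzξ, hx'ξ, form_comm ρ (X.nor (γ s)), hgn'] at this
      have e : b₂ * form ρ (A (x s)) (A (x s)) = 0 := by linarith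
      exact (mul_eq_zero.1 e).resolve_right hVV
    have c3 : b₃ = 0 := by
      have := key (X.nor (γ s))
      rw [hzn, hxn s hs, hgn', X.nor_unit] at this
      linarith
    have hz0 : z = 0 := by rw [hdec, ha, c1, c2, c3]; simp
    exact sub_eq_zero.1 hz0

end ProfileCurve

/-! ### The first integral of the Euler-Lagrange equation -/

/-- The first integral behind the Euler-Lagrange equation. If `q' = -K r'`, `r'' = K q - ρ r` and
`1 / K + r / q` is a nonzero constant `c`, then `exp (1 / (c K))` is a constant multiple of `q`;
hence `(1 - 1 / (c K)) exp (1 / (c K)) = (r / (c q)) exp (1 / (c K))` is a constant multiple of `r`,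
and inherits the second-order linear equation of `r`. -/
lemma eulerLagrange_of_frame {ρ c : ℝ} (hc : c ≠ 0) {I : Set ℝ} (hIo : IsOpen I)
    (hIc : IsPreconnected I) {K r r' q : ℝ → ℝ}
    (hK : ∀ s ∈ I, K s ≠ 0) (hq : ∀ s ∈ I, q s ≠ 0)
    (hr : ∀ s ∈ I, HasDerivAt r (r' s) s)
    (hr' : ∀ s ∈ I, HasDerivAt r' (K s * q s - ρ * r s) s)
    (hq' : ∀ s ∈ I, HasDerivAt q (-(K s * r' s)) s)
    (h : ∀ s ∈ I, 1 / K s + r s / q s = c) :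
    ∀ s ∈ I, EulerLagrange ρ (1 / c) K s := by
  have hexp : ∀ s ∈ I, 1 / c / K s = 1 - 1 / c * (r s / q s) := by
    intro s hs
    have := h s hs
    have h1 : 1 / K s = c - r s / q s := by linarith
    rw [div_eq_mul_one_div (1 / c), h1]
    field_simp
  have hlin : ∀ s ∈ I, q s + K s * r s = c * K s * q s := by
    intro s hs
    have h1 := h s hs
    have h2 := hK s hs
    have h3 := hq s hs
    field_simp at h1
    linarith
  have hd : ∀ s ∈ I, HasDerivAt (fun u => Real.exp (1 / c / K u) / q u) 0 s := by
    intro s hs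
    have h1 := (((((hr s hs).div (hq' s hs) (hq s hs)).const_mul (1 / c)).const_sub 1).exp).div
      (hq' s hs) (hq s hs)
    refine (h1.congr_of_eventuallyEq ?_).congr_deriv ?_
    · filter_upwards [hIo.mem_nhds hs] with u hu
      rw [hexp u hu]; rfl
    · have h3 := hq s hs
      have h2 := hlin s hs
      generalize Real.exp (1 - 1 / c * (r / q) s) = E
      field_simp
      linear_combination (-r' s) * E * h2
  obtain ⟨C, hC⟩ := hIo.exists_is_const_of_deriv_eq_zero hIc
    (fun s hs => (hd s hs).differentiableAt.differentiableWithinAt) (fun s hs => (hd s hs).deriv)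
  have hE : ∀ s ∈ I, Real.exp (1 / c / K s) = C * q s := fun s hs =>
    (div_eq_iff (hq s hs)).1 (hC s hs)
  have hf : ∀ s ∈ I, (1 - 1 / c / K s) * Real.exp (1 / c / K s) = C / c * r s := by
    intro s hs
    have := hq s hs
    rw [hE s hs, hexp s hs]
    field_simp
    ring
  have hf1 : ∀ s ∈ I, deriv (fun u => (1 - 1 / c / K u) * Real.exp (1 / c / K u)) s
      = C / c * r' s := by
    intro s hs
    refine (((hr s hs).const_mul (C / c)).congr_of_eventuallyEq ?_).deriv
    filter_upwards [hIo.mem_nhds hs] with u hu using hf u hu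
  intro s hs
  have hf2 : deriv (deriv (fun u => (1 - 1 / c / K u) * Real.exp (1 / c / K u))) s
      = C / c * (K s * q s - ρ * r s) := by
    refine (((hr' s hs).const_mul (C / c)).congr_of_eventuallyEq ?_).deriv
    filter_upwards [hIo.mem_nhds hs] with u hu using hf1 u hu
  rw [EulerLagrange, hf2]
  linear_combination ρ * hf s hs - 1 / c * K s * hE s hs

end SpaceForms

theorem theorem3p1 {S : Type*} [TopologicalSpace S]
    [ChartedSpace (EuclideanSpace ℝ (Fin 2)) S] [IsManifold (𝓡 2) ∞ S]
    (ρ c : ℝ) (hc : c ≠ 0)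
    (X : SpaceForms.OrientedSurface S ρ)
    (P : Submodule ℝ SpaceForms.Amb) (φ : ℝ → SpaceForms.Amb →L[ℝ] SpaceForms.Amb)
    (hφ : SpaceForms.IsRotationGroup ρ P φ) (hX : X.IsInvariant φ)
    (κ₁ κ₂ : S → ℝ) (hκ : X.ConstantAstigmatism κ₁ κ₂ c)
    (I : Set ℝ) (hIo : IsOpen I) (hIc : IsPreconnected I)
    (γ : ℝ → S) (hγ : X.IsProfileCurve P I γ) :
    ∃ (σ : ℝ) (κ : ℝ → ℝ),
      -- `κ` is the curvature of the profile curve with respect to its unit normal `N = σ η`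
      (∀ s ∈ I, SpaceForms.covAccel ρ (fun u => X.pos (γ u)) s = κ s • (σ • X.nor (γ s))) ∧
      -- `N = -η` if `κ₂` belongs to the profile direction, and `N = η` if `κ₁` does
      ((σ = -1 ∧ ∀ s ∈ I, κ₂ (γ s) = -κ s) ∨ (σ = 1 ∧ ∀ s ∈ I, κ₁ (γ s) = κ s)) ∧
      ContDiffOn ℝ ∞ κ I ∧
      ∀ s ∈ I, κ s ≠ 0 ∧ SpaceForms.EulerLagrange ρ (1 / c) κ s := by
  rcases I.eq_empty_or_nonempty with rfl | hI
  · exact ⟨1, fun _ => 0, by simp, Or.inr (by simp), contDiffOn_empty, by simp⟩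
  have hne : ∀ p, κ₁ p ≠ κ₂ p := by
    intro p h
    obtain ⟨-, -, -, h1⟩ := hκ p
    rw [h, sub_self] at h1
    exact hc h1.symm
  obtain ⟨ℓ, hℓ⟩ := hγ.exists_structure hX hφ (fun p => (hκ p).1) hne hIo hI
  set x : ℝ → SpaceForms.Amb := fun u => X.pos (γ u) with hx
  set n : ℝ → SpaceForms.Amb := fun u => X.nor (γ u) with hn
  set k : ℝ → ℝ := fun s => SpaceForms.form ρ (deriv (deriv x) s) (n s) with hk
  choose! k' l hkl hk' hx0 hl hd1 hd2 hdn hacc using hℓ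
  have hkk : ∀ s ∈ I, k' s = k s := fun s hs => (hk' s hs).symm
  have hks : ContDiffOn ℝ ∞ k I := by
    have h1 : ContMDiffOn 𝓘(ℝ, ℝ) 𝓘(ℝ, SpaceForms.Amb) ∞ x I :=
      X.pos_smooth.comp_contMDiffOn hγ.smooth
    have h2 : ContMDiffOn 𝓘(ℝ, ℝ) 𝓘(ℝ, SpaceForms.Amb) ∞ n I :=
      X.nor_smooth.comp_contMDiffOn hγ.smooth
    have h1 : ContDiffOn ℝ ∞ x I := contMDiffOn_iff_contDiffOn.1 h1
    have h2 : ContDiffOn ℝ ∞ n I := contMDiffOn_iff_contDiffOn.1 h2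
    have h3 := contDiffOn_pi.1 ((h1.deriv_of_isOpen hIo (m := ∞) le_rfl).deriv_of_isOpen hIo
      (m := ∞) le_rfl)
    have h4 := contDiffOn_pi.1 h2
    exact ((((((h3 0).mul (h4 0)).div_const ρ).add ((h3 1).mul (h4 1))).add
      ((h3 2).mul (h4 2))).add ((h3 3).mul (h4 3)))
  have hk0 : ∀ s ∈ I, k s ≠ 0 := by
    intro s hs
    obtain ⟨-, e1, e2, -⟩ := hκ (γ s)
    rw [← hkk s hs]
    rcases hkl s hs with ⟨h1, -⟩ | ⟨h1, -⟩ <;> rw [h1] <;> assumption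
  have hl0 : ∀ s ∈ I, l s ≠ 0 := by
    intro s hs
    obtain ⟨-, e1, e2, -⟩ := hκ (γ s)
    rcases hkl s hs with ⟨-, h1⟩ | ⟨-, h1⟩ <;> rw [h1] <;> assumption
  have hq0 : ∀ s ∈ I, ℓ (n s) ≠ 0 := by
    intro s hs h0
    have := hl s hs
    rw [show ℓ (X.nor (γ s)) = 0 from h0, neg_zero] at this
    exact mul_ne_zero (hl0 s hs) (hx0 s hs) this
  have hlq : ∀ s ∈ I, ℓ (x s) / ℓ (n s) = -(1 / l s) := by
    intro s hs
    have h1 := hl0 s hs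
    have h2 := hq0 s hs
    have h3 : l s * ℓ (x s) = -ℓ (n s) := hl s hs
    field_simp
    linarith
  have hw : ∀ s ∈ I, (k s = κ₁ (γ s) ∧ 1 / k s + ℓ (x s) / ℓ (n s) = c) ∨
      (k s = κ₂ (γ s) ∧ 1 / k s + ℓ (x s) / ℓ (n s) = -c) := by
    intro s hs
    obtain ⟨-, -, -, h1⟩ := hκ (γ s)
    rw [hlq s hs, ← hkk s hs]
    rcases hkl s hs with ⟨h2, h3⟩ | ⟨h2, h3⟩
    · left; rw [h2, h3]; exact ⟨rfl, by linarith⟩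
    · right; rw [h2, h3]; exact ⟨rfl, by linarith⟩
  have hℓx : ∀ s ∈ I, HasDerivAt (fun u => ℓ (x u)) (ℓ (deriv x s)) s := fun s hs =>
    ℓ.hasFDerivAt.comp_hasDerivAt s (hd1 s hs)
  have hℓx' : ∀ s ∈ I, HasDerivAt (fun u => ℓ (deriv x u)) (k s * ℓ (n s) - ρ * ℓ (x s)) s := by
    intro s hs
    refine (ℓ.hasFDerivAt.comp_hasDerivAt s (hd2 s hs)).congr_deriv ?_
    rw [eq_sub_of_add_eq (hacc s hs), map_sub, map_smul, map_smul, hkk s hs]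
    rfl
  have hℓn : ∀ s ∈ I, HasDerivAt (fun u => ℓ (n u)) (-(k s * ℓ (deriv x s))) s := by
    intro s hs
    refine (ℓ.hasFDerivAt.comp_hasDerivAt s (hdn s hs)).congr_deriv ?_
    rw [map_neg, map_smul, hkk s hs]
    rfl
  have hcov : ∀ s ∈ I, SpaceForms.covAccel ρ x s = k s • n s := by
    intro s hs
    rw [SpaceForms.covAccel, hγ.unit_speed s hs, mul_one, ← hkk s hs]
    exact hacc s hs
  have hwc : ContinuousOn (fun s => 1 / k s + ℓ (x s) / ℓ (n s)) I :=
    (continuousOn_const.div hks.continuousOn hk0).add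
      (ContinuousOn.div (fun s hs => (hℓx s hs).continuousAt.continuousWithinAt)
        (fun s hs => (hℓn s hs).continuousAt.continuousWithinAt) hq0)
  have hsq : Set.EqOn ((fun s => 1 / k s + ℓ (x s) / ℓ (n s)) ^ 2) ((fun _ => c) ^ 2) I := by
    intro s hs
    simp only [Pi.pow_apply]
    rcases hw s hs with ⟨-, h1⟩ | ⟨-, h1⟩ <;> rw [h1]
    ring
  -- By continuity, the profile direction carries the same label along the whole curve.
  rcases hIc.eq_or_eq_neg_of_sq_eq hwc continuousOn_const hsq (fun _ => hc) with h | h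
  · refine ⟨1, k, fun s hs => ?_, Or.inr ⟨rfl, fun s hs => ?_⟩, hks, fun s hs => ⟨hk0 s hs, ?_⟩⟩
    · rw [one_smul]; exact hcov s hs
    · rcases hw s hs with ⟨h1, -⟩ | ⟨-, h2⟩
      · exact h1.symm
      · have := h hs
        simp only at this
        exact absurd (by linarith : c = 0) hc
    · exact SpaceForms.eulerLagrange_of_frame hc hIo hIc hk0 hq0 hℓx hℓx' hℓn h s hs
  · refine ⟨-1, fun s => -k s, fun s hs => ?_, Or.inl ⟨rfl, fun s hs => ?_⟩, hks.neg,
      fun s hs => ⟨neg_ne_zero.2 (hk0 s hs), ?_⟩⟩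
    · rw [hcov s hs]; module
    · rcases hw s hs with ⟨-, h2⟩ | ⟨h1, -⟩
      · have := h hs
        simp only [Pi.neg_apply] at this
        exact absurd (by linarith : c = 0) hc
      · rw [neg_neg]; exact h1.symm
    · refine SpaceForms.eulerLagrange_of_frame hc hIo hIc (fun s hs => neg_ne_zero.2 (hk0 s hs))
        (fun s hs => neg_ne_zero.2 (hq0 s hs)) hℓx (fun s hs => ?_) (fun s hs => ?_)
        (fun s hs => ?_) s hs
      · exact (hℓx' s hs).congr_deriv (by ring)
      · exact (hℓn s hs).neg.congr_deriv (by ring)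
      · have := h hs
        simp only [Pi.neg_apply] at this
        rw [div_neg, div_neg]
        linarith
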